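/- **The model.** A network is a finite directed multigraph $(V,E)$ with a transit cost $\tau_e\in\mathbb N$ and a capacity $\gamma_e\in\mathbb N$ for each edge $e$, a source $s$ with only outgoing edges and a destination $d\ne s$ with only incoming edges, such that every other vertex lies on a path from $s$ and on a path to $d$. A path is a finite sequence of edges in which the head of each edge is the tail of the next one; a route is a path from $s$ to $d$. The capacity $\gamma$ of the network is the minimum of $\sum_{e\in C}\gamma_e$ over all cuts $C$, i.e. sets of edges that meet every route. At each stage $t=0,1,2,\dots$ a generation of $\delta$ players departs from $s$; each player chooses a route, and a strategy profile $\sigma$ assigns a route to every player. A player who enters an edge $e$ at stage $a$ reaches its head at stage $a+\tau_e$, and exits $e$ (and enters the next edge of her route) at the first stage $n\ge a+\tau_e$ at which fewer than $\gamma_e$ players are ahead of her in the queue of $e$. The players ahead of her are those who entered $e$ before stage $a$, or at stage $a$ with higher priority, and who have not exited $e$ before stage $n$; players of earlier generations have priority, and within a generation the players are ranked. The latency of a player is the sum of the transit costs of the edges on her route (her transit cost) and of the numbers of stages that she waits at the heads of these edges (her waiting cost, possibly $+\infty$). Let $\bar L_T(\sigma)$ be $\frac1T$ times the sum of the latencies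 of all players of the first $T$ generations. A profile $\sigma$ is socially optimal if $\limsup_T\bar L_T(\sigma)\le\liminf_T\bar L_T(\sigma')$ for every profile $\sigma'$; then $\lim_T \bar L_T(\sigma)$ exists in $[0,\infty]$, is the same for all optimal profiles, and is called the optimal latency. A static feasible flow of value $\delta$ is a map $f:E\to\mathbb N$ with $f_e\le\gamma_e$ for all $e$, conserved at every vertex other than $s,d$, and with inflow $\delta$ at $d$. It is min-cost if it minimizes $\sum_e\tau_ef_e$ among all such flows. A route decomposition of $f$ is a finitely supported family $(F_r)$ of natural numbers indexed by the routes with $\sum_rF_r=\delta$ and $f_e=\sum_rF_r\cdot(\text{number of occurrences of }e\text{ in }r)$ for every edge $e$. **Theorem.** Let $\delta\le\gamma$. There is a min-cost static feasible flow of value $\delta$ that has a route decomposition. Moreover, for every min-cost static feasible flow $f^*$ of value $\delta$ and every route decomposition $F^*$ of $f^*$: 1. there is a socially optimal strategy profile under which, at every stage, exactly $F^*_r$ players choose route $r$, for each route $r$, and under which no player ever waits on any edge (no queues are ever created); 2. the optimal latency equals the static min-cost value: $\lim_T\bar L_T(\sigma)=\sum_e\tau_ef^*_e$ for every socially optimal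 profile $\sigma$. -/

import Mathlib

open Filter Topology
open scoped ENNReal

/-- `l` is a path from `u` to `v`: a nonempty finite sequence of edges, the head of each being the
tail of the next, starting at `u` and ending at `v`. -/
def IsPath {V E : Type*} (tail head : E → V) (u v : V) (l : List E) : Prop :=
  l.IsChain (fun e e' => head e = tail e') ∧
    l.head?.map tail = some u ∧ l.getLast?.map head = some v

/-- A network: a directed multigraph with vertices `V` and edges `E`, a free-flow transit cost and
a capacity for each edge, a source with only outgoing edges and a destination with only incoming
edges, every other vertex lying on a path from the source and on a path to the destination. -/
structure Network (V E : Type*) where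
  tail : E → V
  head : E → V
  transit : E → ℕ
  cap : E → ℕ
  source : V
  dest : V
  source_ne_dest : source ≠ dest
  head_ne_source : ∀ e, head e ≠ source
  tail_ne_dest : ∀ e, tail e ≠ dest
  path_from_source : ∀ v, v ≠ source → v ≠ dest → ∃ l, IsPath tail head source v l
  path_to_dest : ∀ v, v ≠ source → v ≠ dest → ∃ l, IsPath tail head v dest l

/-- The players when `δ` of them depart at each stage: the `i`-th player of the generation that
departs at stage `t` (stages are numbered from `0`). The lexicographic order is the global
priority: smaller players have priority. -/
abbrev Player (δ : ℕ) : Type := ℕ ×ₗ Fin δ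

/-- The `i`-th player of generation `t`. -/
def Player.mk {δ : ℕ} (t : ℕ) (i : Fin δ) : Player δ := toLex (t, i)

/-- The stage at which a player departs from the source. -/
def Player.departure {δ : ℕ} (p : Player δ) : ℕ := (ofLex p).1

namespace Network

variable {V E : Type*} (N : Network V E)

/-- A route is a path from the source to the destination. -/
def Route : Type _ := {l : List E // IsPath N.tail N.head N.source N.dest l}

instance [DecidableEq E] : DecidableEq N.Route :=
  inferInstanceAs (DecidableEq {l : List E // IsPath N.tail N.head N.source N.dest l})

variable {N}

/-- The sequence of edges of a route. -/
def Route.edges (r : N.Route) : List E := r.1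

variable (N)

/-! ### Cuts and capacity -/

/-- A cut is a set of edges that meets every route. -/
def IsCut (C : Finset E) : Prop := ∀ r : N.Route, ∃ e ∈ C, e ∈ r.edges

/-- The capacity of the network: the least capacity `∑ e ∈ C, γ_e` of a cut `C`. -/
noncomputable def capacity : ℕ := sInf {c | ∃ C : Finset E, N.IsCut C ∧ c = ∑ e ∈ C, N.cap e}

/-- There is a cut, so the minimum that defines the capacity is attained. -/
theorem isCut_univ [Fintype E] : N.IsCut Finset.univ := by
  intro r
  obtain ⟨l, _, h, _⟩ := r
  cases l with
  | nil => simp at h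
  | cons e l => exact ⟨e, Finset.mem_univ e, List.mem_cons_self⟩

/-! ### Static flows -/

/-- An (integral) feasible static flow of value `δ`: it obeys the capacities, it is conserved at
every vertex other than the source and the destination, and the inflow at the destination
is `δ`. -/
structure IsFeasibleFlow [Fintype E] [DecidableEq V] (δ : ℕ) (f : E → ℕ) : Prop where
  le_cap : ∀ e, f e ≤ N.cap e
  conserved : ∀ v, v ≠ N.source → v ≠ N.dest →
    ∑ e with N.head e = v, f e = ∑ e with N.tail e = v, f e
  value : ∑ e with N.head e = N.dest, f e = δ

/-- The total transit cost of a static flow. -/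
def flowCost [Fintype E] (f : E → ℕ) : ℕ := ∑ e, N.transit e * f e

/-- `f` is a min-cost flow: it minimizes the total transit cost among all feasible flows of
value `δ`. -/
def IsMinCostFlow [Fintype E] [DecidableEq V] (δ : ℕ) (f : E → ℕ) : Prop :=
  N.IsFeasibleFlow δ f ∧ ∀ g, N.IsFeasibleFlow δ g → N.flowCost f ≤ N.flowCost g

/-- The flow over routes `F` has `δ` players and induces the flow `f` over edges; a route that
passes several times through an edge contributes to it each time. -/
def IsRouteDecomposition [DecidableEq E] (δ : ℕ) (F : N.Route →₀ ℕ) (f : E → ℕ) : Prop :=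
  (F.sum fun _ n => n) = δ ∧ ∀ e, f e = F.sum fun r n => n * r.edges.count e

/-! ### The dynamics -/

/-- A strategy profile: each player chooses a route. -/
abbrev Profile (δ : ℕ) : Type _ := Player δ → N.Route

variable {N} {δ : ℕ}

/-- In these definitions `T p k` stands for the stage at which player `p` exits the `k`-th edge of
her route and enters the next one (for `k = 0`: departs from the source), and is `⊤` if this never
happens. So the `k`-th passage `(p, k)` of `p`, counted from `0`, is along the edge
`(σ p).edges[k]`, which she enters at stage `T p k` and exits at stage `T p (k + 1)`.

`ahead σ T p k e n` is the set of passages along the edge `e` that are ahead of `(p, k)` in the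
queue of `e` at stage `n`: they entered `e` before `(p, k)`, or at the same stage and with priority
over it, and they have not exited `e` before stage `n`. -/
def ahead (σ : N.Profile δ) (T : Player δ → ℕ → ℕ∞) (p : Player δ) (k : ℕ) (e : E) (n : ℕ) :
    Set (Player δ × ℕ) :=
  {v | (σ v.1).edges[v.2]? = some e ∧
    (T v.1 v.2 < T p k ∨ T v.1 v.2 = T p k ∧ (v.1 < p ∨ v.1 = p ∧ v.2 < k)) ∧
    (n : ℕ∞) ≤ T v.1 (v.2 + 1)}

/-- Player `p`, on the `k`-th edge `e` of her route, may have exited it at stage `n`: she has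
reached the head of `e`, and fewer than `γ_e` players are ahead of her in the queue. -/
def CanExit (σ : N.Profile δ) (T : Player δ → ℕ → ℕ∞) (p : Player δ) (k : ℕ) (e : E) (n : ℕ) :
    Prop :=
  T p k + N.transit e ≤ n ∧ (ahead σ T p k e n).encard < N.cap e

/-- `T` is the course of the network under `σ`: each player departs at her stage, and exits each
edge at the first stage at which she can. (After the last edge, `T` is constant.) -/
structure IsRun (σ : N.Profile δ) (T : Player δ → ℕ → ℕ∞) : Prop where
  start : ∀ p, T p 0 = (p.departure : ℕ∞)
  step : ∀ p k e, (σ p).edges[k]? = some e →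
    T p (k + 1) = sInf ((fun n : ℕ => (n : ℕ∞)) '' {n | CanExit σ T p k e n})
  finish : ∀ p k, (σ p).edges[k]? = none → T p (k + 1) = T p k

/-- Keys for the recursion: stage, then player, then passage. -/
abbrev Key (δ : ℕ) : Type := ℕ ×ₗ (Player δ ×ₗ ℕ)

/-- The key of stage `s`, player `q`, passage `j`. -/
def key (s : ℕ) (q : Player δ) (j : ℕ) : Key δ := toLex (s, toLex (q, j))

theorem key_lt {s t : ℕ} {q p : Player δ} {j k : ℕ} :
    key s q j < key t p k ↔ s < t ∨ s = t ∧ (q < p ∨ q = p ∧ j < k) := by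
  simp [key, Prod.Lex.toLex_lt_toLex]

/-- Whether `p` can exit at a stage `n ≤ t` depends only on the entries of `T` with a key below
that of `(t, p, k + 1)`. -/
theorem CanExit.congr {σ : N.Profile δ} {A B : Player δ → ℕ → ℕ∞} {p : Player δ} {k t n : ℕ} {e : E}
    (h : ∀ (s : ℕ) q j, key s q j < key t p (k + 1) → (A q j = s ↔ B q j = s)) (hn : n ≤ t)
    (hA : CanExit σ A p k e n) : CanExit σ B p k e n := by
  have fin : ∀ {x : ℕ∞} {m : ℕ}, x ≤ m → ∃ s : ℕ, x = s ∧ s ≤ m := by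
    intro x m hx
    obtain ⟨s, rfl⟩ := ENat.ne_top_iff_exists.1 (ne_top_of_le_ne_top (ENat.natCast_ne_top m) hx)
    exact ⟨s, rfl, by exact_mod_cast hx⟩
  obtain ⟨h1, h2⟩ := hA
  obtain ⟨a, ha, han⟩ := fin (le_trans le_self_add h1)
  have hb : B p k = a := (h a p k (key_lt.2 (by
    rcases Nat.lt_or_ge a t with h | h
    · exact Or.inl h
    · exact Or.inr ⟨by omega, Or.inr ⟨rfl, by omega⟩⟩))).1 ha
  -- below stage `t` the two tables agree
  have low : ∀ q j (s : ℕ), s < t → (A q j = s ↔ B q j = s) := fun q j s hs =>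
    h s q j (key_lt.2 (Or.inl hs))
  have lt_iff : ∀ q j (m : ℕ), m ≤ t → (A q j < m ↔ B q j < m) := by
    intro q j m hm
    constructor
    · intro hlt
      obtain ⟨s, hs, -⟩ := fin hlt.le
      rw [hs] at hlt
      have : s < m := by exact_mod_cast hlt
      rw [(low q j s (by omega)).1 hs]; exact_mod_cast this
    · intro hlt
      obtain ⟨s, hs, -⟩ := fin hlt.le
      rw [hs] at hlt
      have : s < m := by exact_mod_cast hlt
      rw [(low q j s (by omega)).2 hs]; exact_mod_cast this
  have hset : ahead σ A p k e n = ahead σ B p k e n := by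
    ext ⟨q, j⟩
    simp only [ahead, Set.mem_ofPred_eq, ha, hb]
    have e1 := lt_iff q j a (by omega)
    have e2 := lt_iff q (j + 1) n hn
    rw [← not_lt, ← not_lt, e1, e2]
    have e3 : (q < p ∨ q = p ∧ j < k) → (A q j = a ↔ B q j = a) := by
      intro hq
      refine h a q j (key_lt.2 ?_)
      rcases Nat.lt_or_ge a t with h' | h'
      · exact Or.inl h'
      · refine Or.inr ⟨by omega, hq.imp id ?_⟩
        rintro ⟨h1, h2⟩
        exact ⟨h1, by omega⟩
    tauto
  exact ⟨by rw [hb, ← ha]; exact h1, by rw [← hset]; exact h2⟩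

/-- One step of the recursion: given the table `f` of the keys already treated (`f` holds at
`(s, q, j)` if `q` has passed `j` edges by stage `s`), whether this holds at the key `x`. -/
def recStep (σ : N.Profile δ) (x : Key δ) (f : ∀ y, y < x → Prop) : Prop :=
  let S : Player δ → ℕ → ℕ∞ := fun q j =>
    sInf ((fun n : ℕ => (n : ℕ∞)) '' {s | ∃ h : key s q j < x, f (key s q j) h})
  let t := (ofLex x).1
  let p := (ofLex (ofLex x).2).1
  match (ofLex (ofLex x).2).2 with
  | 0 => p.departure ≤ t
  | k + 1 => match (σ p).edges[k]? with
    | some e => ∃ n ≤ t, CanExit σ S p k e n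
    | none => S p k ≤ t

theorem sInf_coe_le {s : Set ℕ} {t : ℕ} :
    sInf ((fun n : ℕ => (n : ℕ∞)) '' s) ≤ t ↔ ∃ n ∈ s, n ≤ t := by
  constructor
  · intro h
    have hne : ((fun n : ℕ => (n : ℕ∞)) '' s).Nonempty := by
      by_contra hc
      rw [Set.not_nonempty_iff_eq_empty.1 hc, sInf_empty] at h
      exact ENat.natCast_ne_top t (top_le_iff.1 h)
    obtain ⟨n, hn, hn'⟩ := csInf_mem hne
    refine ⟨n, hn, ?_⟩
    rw [← hn'] at h
    exact Nat.cast_le.1 h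
  · rintro ⟨n, hn, hle⟩
    exact le_trans (sInf_le ⟨n, hn, rfl⟩) (Nat.cast_le.2 hle)

theorem enat_eq_of_le_iff {x y : ℕ∞} (h : ∀ t : ℕ, x ≤ t ↔ y ≤ t) : x = y := by
  apply le_antisymm
  · rcases eq_or_ne y ⊤ with hy | hy
    · simp [hy]
    · obtain ⟨m, rfl⟩ := ENat.ne_top_iff_exists.1 hy
      exact (h m).2 le_rfl
  · rcases eq_or_ne x ⊤ with hy | hy
    · simp [hy]
    · obtain ⟨m, rfl⟩ := ENat.ne_top_iff_exists.1 hy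
      exact (h m).1 le_rfl

/-- The rules determine a course of the network. -/
theorem exists_isRun (σ : N.Profile δ) : ∃ T, IsRun σ T := by
  have wf : WellFounded (fun x y : Key δ => x < y) := wellFounded_lt
  let P : Key δ → Prop := wf.fix (C := fun _ => Prop) (recStep σ)
  have hP : ∀ x, P x = recStep σ x (fun y _ => P y) := fun x => wf.fix_eq (C := fun _ => Prop) _ x
  let T : Player δ → ℕ → ℕ∞ := fun q j =>
    sInf ((fun n : ℕ => (n : ℕ∞)) '' {s | P (key s q j)})
  let S : Key δ → Player δ → ℕ → ℕ∞ := fun x q j =>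
    sInf ((fun n : ℕ => (n : ℕ∞)) '' {s | ∃ _ : key s q j < x, P (key s q j)})
  have hTle : ∀ q j (t : ℕ), T q j ≤ t ↔ ∃ n, P (key n q j) ∧ n ≤ t := fun q j t => sInf_coe_le
  have hSle : ∀ x q j (t : ℕ),
      S x q j ≤ t ↔ ∃ n, (∃ _ : key n q j < x, P (key n q j)) ∧ n ≤ t := fun x q j t => sInf_coe_le
  have kmono : ∀ {n s : ℕ} {q : Player δ} {j : ℕ} {x : Key δ}, n ≤ s → key s q j < x →
      key n q j < x := by
    intro n s q j x hns hx
    rcases Nat.lt_or_ge n s with h | h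
    · exact lt_trans (key_lt.2 (Or.inl h)) hx
    · rwa [le_antisymm hns h]
  have hST' : ∀ x (s : ℕ) q j, key s q j < x → ∀ m ≤ s, (S x q j ≤ (m : ℕ) ↔ T q j ≤ (m : ℕ)) := by
    intro x s q j hx m hm
    rw [hTle, hSle]
    constructor
    · rintro ⟨n, ⟨_, h⟩, hn⟩
      exact ⟨n, h, hn⟩
    · rintro ⟨n, h, hn⟩
      exact ⟨n, ⟨kmono (by omega) hx, h⟩, hn⟩
  have eqiff : ∀ (a : ℕ∞) (s : ℕ), a = s ↔ a ≤ s ∧ ∀ m < s, ¬ a ≤ (m : ℕ) := by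
    intro a s
    constructor
    · rintro rfl
      refine ⟨le_rfl, fun m hm h => ?_⟩
      have : s ≤ m := by exact_mod_cast h
      omega
    · rintro ⟨h1, h2⟩
      obtain ⟨n, rfl⟩ := ENat.ne_top_iff_exists.1 (ne_top_of_le_ne_top (ENat.natCast_ne_top s) h1)
      have : n ≤ s := by exact_mod_cast h1
      rcases Nat.lt_or_ge n s with h | h
      · exact absurd le_rfl (h2 n h)
      · rw [le_antisymm this h]
  have hST : ∀ x (s : ℕ) q j, key s q j < x → (S x q j = s ↔ T q j = s) := by
    intro x s q j hx
    rw [eqiff, eqiff, hST' x s q j hx s le_rfl]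
    refine and_congr_right fun _ => forall₂_congr fun m hm => ?_
    rw [hST' x s q j hx m hm.le]
  refine ⟨T, ⟨fun p => ?_, fun p k e he => ?_, fun p k he => ?_⟩⟩
  · apply enat_eq_of_le_iff
    intro t
    rw [hTle]
    have : ∀ n, P (key n p 0) ↔ p.departure ≤ n := fun n => by rw [hP]; rfl
    simp only [this]
    constructor
    · rintro ⟨n, h1, h2⟩
      exact_mod_cast le_trans h1 h2
    · intro h
      exact ⟨p.departure, le_rfl, by exact_mod_cast h⟩
  · have key1 : ∀ n, P (key n p (k + 1)) ↔
        ∃ m ≤ n, CanExit σ (S (key n p (k + 1))) p k e m := by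
      intro n
      rw [hP]
      simp only [recStep, key, ofLex_toLex, he]
      rfl
    have key2 : ∀ n, P (key n p (k + 1)) ↔ ∃ m ≤ n, CanExit σ T p k e m := by
      intro n
      rw [key1]
      refine exists_congr fun m => and_congr_right fun hm => ?_
      exact ⟨CanExit.congr (hST _) hm, CanExit.congr (fun s q j h => (hST _ s q j h).symm) hm⟩
    apply enat_eq_of_le_iff
    intro t
    rw [hTle, sInf_coe_le]
    simp only [key2, Set.mem_ofPred_eq]
    constructor
    · rintro ⟨n, ⟨m, h1, h2⟩, h3⟩
      exact ⟨m, h2, by omega⟩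
    · rintro ⟨m, h2, h3⟩
      exact ⟨m, ⟨m, le_rfl, h2⟩, h3⟩
  · have key1 : ∀ n, P (key n p (k + 1)) ↔ S (key n p (k + 1)) p k ≤ n := by
      intro n
      rw [hP]
      simp only [recStep, key, ofLex_toLex, he]
      rfl
    have key2 : ∀ n, P (key n p (k + 1)) ↔ T p k ≤ n := by
      intro n
      rw [key1]
      exact hST' _ n p k (key_lt.2 (Or.inr ⟨rfl, Or.inr ⟨rfl, by omega⟩⟩)) n le_rfl
    apply enat_eq_of_le_iff
    intro t
    rw [hTle]
    simp only [key2]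
    constructor
    · rintro ⟨n, h1, h2⟩
      exact le_trans h1 (by exact_mod_cast h2)
    · intro h
      exact ⟨t, h, le_rfl⟩

/-- The rules determine only one course of the network. -/
theorem IsRun.unique {σ : N.Profile δ} {A B : Player δ → ℕ → ℕ∞} (hA : IsRun σ A)
    (hB : IsRun σ B) : A = B := by
  have main : ∀ x : Key δ, ∀ s q j, x = key s q j → (A q j = (s : ℕ) ↔ B q j = (s : ℕ)) := by
    intro x
    induction x using WellFoundedLT.induction with
    | _ x ih =>
      rintro s q j rfl
      have ih' : ∀ (s' : ℕ) q' j', key s' q' j' < key s q j → (A q' j' = s' ↔ B q' j' = s') :=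
        fun s' q' j' h => ih _ h s' q' j' rfl
      cases j with
      | zero => rw [hA.start, hB.start]
      | succ k =>
        cases he : (σ q).edges[k]? with
        | none =>
          rw [hA.finish q k he, hB.finish q k he]
          exact ih' s q k (key_lt.2 (Or.inr ⟨rfl, Or.inr ⟨rfl, by omega⟩⟩))
        | some e =>
          have hle : ∀ m ≤ s, (A q (k + 1) ≤ (m : ℕ) ↔ B q (k + 1) ≤ (m : ℕ)) := by
            intro m hm
            rw [hA.step q k e he, hB.step q k e he, sInf_coe_le, sInf_coe_le]
            refine exists_congr fun n => ⟨fun h => ⟨?_, h.2⟩, fun h => ⟨?_, h.2⟩⟩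
            · exact CanExit.congr ih' (by omega) h.1
            · exact CanExit.congr (fun s' q' j' hh => (ih' s' q' j' hh).symm) (by omega) h.1
          constructor
          · intro h
            apply le_antisymm ((hle s le_rfl).1 h.le)
            by_contra hc
            obtain ⟨m, hm⟩ := ENat.ne_top_iff_exists.1 (ne_top_of_lt (not_le.1 hc))
            rw [← hm] at hc
            have hms : m < s := by
              by_contra h'
              exact hc (by exact_mod_cast not_lt.1 h')
            have := (hle m hms.le).2 hm.ge
            rw [h] at this
            have : s ≤ m := by exact_mod_cast this
            omega
          · intro h
            apply le_antisymm ((hle s le_rfl).2 h.le)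
            by_contra hc
            obtain ⟨m, hm⟩ := ENat.ne_top_iff_exists.1 (ne_top_of_lt (not_le.1 hc))
            rw [← hm] at hc
            have hms : m < s := by
              by_contra h'
              exact hc (by exact_mod_cast not_lt.1 h')
            have := (hle m hms.le).1 hm.ge
            rw [h] at this
            have : s ≤ m := by exact_mod_cast this
            omega
  funext q j
  rcases eq_or_ne (A q j) ⊤ with h | h
  · rw [h]
    by_contra hc
    obtain ⟨m, hm⟩ := ENat.ne_top_iff_exists.1 (Ne.symm hc)
    have := (main _ m q j rfl).2 hm.symm
    rw [h] at this
    exact ENat.natCast_ne_top m this.symm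
  · obtain ⟨m, hm⟩ := ENat.ne_top_iff_exists.1 h
    rw [← hm]
    exact ((main _ m q j rfl).1 hm.symm).symm

/-- The course of the network under `σ`: `run σ p k` is the stage at which player `p` exits the
`k`-th edge of her route (departs, if `k = 0`). -/
noncomputable def run (σ : N.Profile δ) : Player δ → ℕ → ℕ∞ := (exists_isRun σ).choose

theorem isRun_run (σ : N.Profile δ) : IsRun σ (run σ) := (exists_isRun σ).choose_spec

/-! ### Latencies and optimality -/

/-- The transit cost paid by player `p`. -/
def transitCost (σ : N.Profile δ) (p : Player δ) : ℕ := ((σ p).edges.map N.transit).sum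

/-- The number of stages that player `p` spends queueing on the `k`-th edge of her route (counted
from `0`): from her arrival at its head until her exit. -/
noncomputable def edgeWait (σ : N.Profile δ) (p : Player δ) (k : Fin (σ p).edges.length) : ℕ∞ :=
  run σ p (k + 1) - (run σ p k + N.transit (σ p).edges[k])

/-- The waiting cost paid by player `p`. -/
noncomputable def waitingCost (σ : N.Profile δ) (p : Player δ) : ℕ∞ := ∑ k, edgeWait σ p k

/-- The latency suffered by player `p`. -/
noncomputable def latency (σ : N.Profile δ) (p : Player δ) : ℕ∞ :=
  transitCost σ p + waitingCost σ p

/-- The total latency of the generation that departs at stage `t`. -/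
noncomputable def totalLatency (σ : N.Profile δ) (t : ℕ) : ℕ∞ :=
  ∑ i : Fin δ, latency σ (Player.mk t i)

/-- The average total latency of the first `T` generations. -/
noncomputable def avgLatency (σ : N.Profile δ) (T : ℕ) : ℝ≥0∞ :=
  (∑ t ∈ Finset.range T, (totalLatency σ t : ℝ≥0∞)) / (T : ℝ≥0∞)

/-- A strategy profile is (socially) optimal. -/
def IsOptimal (σ : N.Profile δ) : Prop :=
  ∀ σ' : N.Profile δ, limsup (avgLatency σ) atTop ≤ liminf (avgLatency σ') atTop

/-- The number of players who choose route `r` at stage `t`. -/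
def numOnRoute [DecidableEq E] (σ : N.Profile δ) (t : ℕ) (r : N.Route) : ℕ :=
  (Finset.univ.filter fun i : Fin δ => σ (Player.mk t i) = r).card

end Network

/-! Repeating a min-cost flow forever attains its cost, and linear programming duality, carried out
over time, shows that no profile does better.

Upper bound. Let all generations use one assignment of routes that realizes `F`. On the timetable
without waiting, two passages that enter `e` at the same stage differ in rank or in passage number,
so at most `f e ≤ γ_e` of them enter together. Such a timetable obeys the queueing rules
(`isRun_freeRun`), hence is the run by `IsRun.unique`, and each generation pays exactly the static
cost.

Lower bound. `Arc.exists_potential` yields potentials `π` in complementary slackness with `f`: least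
costs of residual walks, which are finite because a min-cost flow has no negative residual cycle.
Put `Δ = π dest - π source`. Along any route, transit costs plus edge prices are at least `Δ`. An
edge releases at most `γ_e` passages per stage (`card_exits_le`), so the players of the first `T`
generations with latency below `Δ⁺` pass it at most `γ_e (T + Δ⁺)` times; the others already pay
`Δ`. Summing, the total latency is at least `T (δ Δ - ∑ γ_e price_e)` minus a constant
(`dual_le_sum_totalLatency`). The bracket is the flow cost (`flowCost_eq_dual`), and the constant
vanishes in the average.

A decomposable min-cost flow exists by max-flow min-cut, followed by peeling off routes; the
remaining circulation is discarded, which cannot raise the cost. -/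

/-! ### Walks along arcs

An arc is an edge together with a direction: `(e, true)` runs from the tail of `e` to its head,
`(e, false)` from the head to the tail. -/

namespace Arc

variable {V E : Type*} (tail head : E → V)

/-- The vertex at which an arc starts. -/
def src (a : E × Bool) : V := if a.2 then tail a.1 else head a.1

/-- The vertex at which an arc ends. -/
def tgt (a : E × Bool) : V := if a.2 then head a.1 else tail a.1

/-- The sign with which an arc changes the flow on its edge. -/
def sign (a : E × Bool) : ℤ := if a.2 then 1 else -1

/-- `l` is a walk from `u` to `v` (possibly empty). -/
def IsWalk (u v : V) : List (E × Bool) → Prop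
  | [] => u = v
  | a :: l => src tail head a = u ∧ IsWalk (tgt tail head a) v l

/-- The cost of a walk: edges traversed backwards have their cost negated. -/
def cost (c : E → ℤ) (l : List (E × Bool)) : ℤ := (l.map fun a => sign a * c a.1).sum

/-- The change of the flow on the edge `e` when a unit of flow is sent along a walk. -/
def net [DecidableEq E] (l : List (E × Bool)) (e : E) : ℤ :=
  (l.map fun a => if a.1 = e then sign a else 0).sum

variable {tail head}

theorem isWalk_append {u v : V} {l m : List (E × Bool)} :
    IsWalk tail head u v (l ++ m) ↔ ∃ w, IsWalk tail head u w l ∧ IsWalk tail head w v m := by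
  induction l generalizing u with
  | nil => simp [IsWalk]
  | cons a l ih => simp [IsWalk, ih, and_assoc]

theorem cost_append (c : E → ℤ) (l m : List (E × Bool)) :
    cost c (l ++ m) = cost c l + cost c m := by
  simp [cost]

theorem cost_cons (c : E → ℤ) (a : E × Bool) (l : List (E × Bool)) :
    cost c (a :: l) = sign a * c a.1 + cost c l := by
  simp [cost]

theorem net_cons [DecidableEq E] (a : E × Bool) (l : List (E × Bool)) (e : E) :
    net (a :: l) e = (if a.1 = e then sign a else 0) + net l e := by
  simp [net]

/-- A walk that uses an edge twice splits into a shorter walk and a shorter closed walk. -/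
theorem IsWalk.split {u v : V} {l : List (E × Bool)} (hl : IsWalk tail head u v l)
    (hd : ¬ (l.map Prod.fst).Nodup) (c : E → ℤ) :
    ∃ w m k, IsWalk tail head u v m ∧ IsWalk tail head w w k ∧ m.length < l.length ∧
      k.length < l.length ∧ m ⊆ l ∧ k ⊆ l ∧ cost c l = cost c m + cost c k := by
  have hsplit : ∃ P a X b Q, l = P ++ a :: (X ++ b :: Q) ∧ a.1 = b.1 := by
    clear hl
    induction l with
    | nil => simp at hd
    | cons a l ih =>
      by_cases h : a.1 ∈ l.map Prod.fst
      · obtain ⟨b, hb, hab⟩ := List.mem_map.1 h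
        obtain ⟨X, Q, rfl⟩ := List.append_of_mem hb
        exact ⟨[], a, X, b, Q, rfl, hab.symm⟩
      · rw [List.map_cons, List.nodup_cons] at hd
        obtain ⟨P, a', X, b, Q, rfl, hab⟩ := ih (fun h' => hd ⟨h, h'⟩)
        exact ⟨a :: P, a', X, b, Q, rfl, hab⟩
  obtain ⟨P, ⟨e, i⟩, X, ⟨e', j⟩, Q, rfl, hab⟩ := hsplit
  obtain rfl : e = e' := hab
  obtain ⟨w, hP, ha, h⟩ := isWalk_append.1 hl
  obtain ⟨z, hX, hb, hQ⟩ := isWalk_append.1 h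
  -- Same direction: the stretch from one use of the edge to the next is a cycle. Opposite
  -- directions: the two uses cancel, and what lies between them is a cycle.
  by_cases hij : i = j
  · subst hij
    refine ⟨w, P ++ (e, i) :: Q, (e, i) :: X, isWalk_append.2 ⟨w, hP, ha, hQ⟩, ⟨ha, ?_⟩, ?_, ?_,
      ?_, ?_, ?_⟩
    · rwa [show w = z from ha.symm.trans hb]
    · simp
    · simp; omega
    · intro x; simp; tauto
    · intro x; simp; tauto
    · simp only [cost_append, cost_cons]; ring
  · have h1 : tgt tail head (e, j) = w := by
      rw [← ha]; cases i <;> cases j <;> simp_all [src, tgt]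
    have h2 : tgt tail head (e, i) = z := by
      rw [← hb]; cases i <;> cases j <;> simp_all [src, tgt]
    rw [h1] at hQ
    rw [h2] at hX
    refine ⟨z, P ++ Q, X, isWalk_append.2 ⟨w, hP, hQ⟩, hX, ?_, ?_, ?_, ?_, ?_⟩
    · simp; omega
    · simp; omega
    · intro x; simp; tauto
    · intro x; simp; tauto
    · simp only [cost_append, cost_cons]
      cases i <;> cases j <;> simp_all [sign] <;> ring

/-- A walk can be shortened to one that uses each edge at most once. -/
theorem IsWalk.exists_nodup {u v : V} {l : List (E × Bool)} (hl : IsWalk tail head u v l) :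
    ∃ m, IsWalk tail head u v m ∧ m ⊆ l ∧ (m.map Prod.fst).Nodup := by
  induction h : l.length using Nat.strong_induction_on generalizing l with
  | _ n ih =>
    by_cases hd : (l.map Prod.fst).Nodup
    · exact ⟨l, hl, List.Subset.refl l, hd⟩
    · obtain ⟨w, m, k, hm, -, hlt, -, hml, -, -⟩ := hl.split hd 0
      obtain ⟨m', h1, h2, h3⟩ := ih m.length (by omega) hm rfl
      exact ⟨m', h1, fun a ha => hml (h2 ha), h3⟩

theorem net_eq_zero [DecidableEq E] {l : List (E × Bool)} {e : E} (h : e ∉ l.map Prod.fst) :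
    net l e = 0 := by
  apply List.sum_eq_zero
  intro x hx
  obtain ⟨a, ha, rfl⟩ := List.mem_map.1 hx
  rw [if_neg]
  rintro rfl
  exact h (List.mem_map_of_mem ha)

/-! ### Residual arcs and the optimality criterion -/

/-- The arcs along which the flow `f` may be changed by one. -/
def Residual (cap f : E → ℕ) (a : E × Bool) : Prop := if a.2 then f a.1 < cap a.1 else 0 < f a.1

/-- With no edge repeated, each edge changes by at most one unit, and residuality leaves room for
exactly that unit. -/
theorem add_net_mem [DecidableEq E] {cap f : E → ℕ} (hf : ∀ e, f e ≤ cap e) {l : List (E × Bool)}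
    (hd : (l.map Prod.fst).Nodup) (hr : ∀ a ∈ l, Residual cap f a) (e : E) :
    0 ≤ f e + net l e ∧ f e + net l e ≤ cap e := by
  induction l with
  | nil => simpa [net] using hf e
  | cons a l ih =>
    rw [List.map_cons, List.nodup_cons] at hd
    rw [net_cons]
    by_cases h : a.1 = e
    · subst h
      rw [if_pos rfl, net_eq_zero hd.1]
      have h1 := hr a List.mem_cons_self
      have h2 := hf a.1
      unfold Residual at h1
      unfold sign
      split_ifs at h1 ⊢ <;> omega
    · rw [if_neg h, zero_add]
      exact ih hd.2 fun b hb => hr b (List.mem_cons_of_mem a hb)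

/-- In either direction an arc moves one unit of divergence from its start to its end, so the
contributions telescope. -/
theorem IsWalk.sum_net [Fintype E] [DecidableEq E] [DecidableEq V] {u v : V}
    {l : List (E × Bool)} (hl : IsWalk tail head u v l) (w : V) :
    ∑ e with head e = w, net l e - ∑ e with tail e = w, net l e =
      (if v = w then 1 else 0) - (if u = w then 1 else 0) := by
  induction l generalizing u with
  | nil =>
    obtain rfl : u = v := hl
    simp [net]
  | cons a l ih =>
    have := ih hl.2
    obtain ⟨h, -⟩ := hl
    simp only [net_cons, Finset.sum_add_distrib, Finset.sum_ite_eq, Finset.mem_filter,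
      Finset.mem_univ, true_and]
    rw [← h]
    unfold src tgt sign at *
    split_ifs at * <;> omega

theorem sum_mul_net [Fintype E] [DecidableEq E] (c : E → ℤ) (l : List (E × Bool)) :
    ∑ e, c e * net l e = cost c l := by
  induction l with
  | nil => simp [net, cost]
  | cons a l ih =>
    simp only [net_cons, cost_cons, mul_add, Finset.sum_add_distrib, ih]
    simp [mul_comm]

/-- A bound independent of the walk; it makes the infimum that defines the potential finite. -/
theorem neg_sum_abs_le_cost [Fintype E] (c : E → ℤ) {l : List (E × Bool)}
    (hd : (l.map Prod.fst).Nodup) : -∑ e, |c e| ≤ cost c l := by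
  classical
  have h1 : -((l.map Prod.fst).map fun e => |c e|).sum ≤ cost c l := by
    clear hd
    induction l with
    | nil => simp [cost]
    | cons a l ih =>
      rw [cost_cons]
      simp only [List.map_cons, List.sum_cons]
      have : -|c a.1| ≤ sign a * c a.1 := by
        unfold sign
        split_ifs
        · simpa using neg_abs_le (c a.1)
        · simpa using le_abs_self (c a.1)
      linarith
  have h2 : ((l.map Prod.fst).map fun e => |c e|).sum ≤ ∑ e, |c e| := by
    rw [← List.sum_toFinset _ hd]
    exact Finset.sum_le_sum_of_subset_of_nonneg (Finset.subset_univ _) fun e _ _ => abs_nonneg _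
  linarith

/-- **Optimality criterion**: if `f` has least cost among the flows that obey the capacities and
have the same divergence, then there are potentials for which `f` satisfies complementary
slackness. -/
theorem exists_potential [Fintype E] [DecidableEq E] [DecidableEq V] {cap f : E → ℕ}
    (hf : ∀ e, f e ≤ cap e) (c : E → ℤ)
    (hmin : ∀ g : E → ℕ, (∀ e, g e ≤ cap e) →
      (∀ v, (∑ e with head e = v, (g e : ℤ)) - ∑ e with tail e = v, (g e : ℤ) =
        (∑ e with head e = v, (f e : ℤ)) - ∑ e with tail e = v, (f e : ℤ)) →
      ∑ e, c e * f e ≤ ∑ e, c e * g e) :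
    ∃ π : V → ℤ, ∀ e, (f e < cap e → 0 ≤ c e + π (tail e) - π (head e)) ∧
      (0 < f e → c e + π (tail e) - π (head e) ≤ 0) := by
  -- No negative residual cycle: a cycle without repeated edges can be added to `f`, giving a
  -- competitor with the same divergence; other cycles split into shorter ones.
  have closed : ∀ n, ∀ l : List (E × Bool), l.length = n → ∀ u, IsWalk tail head u u l →
      (∀ a ∈ l, Residual cap f a) → 0 ≤ cost c l := by
    intro n
    induction n using Nat.strong_induction_on with
    | _ n ih =>
      rintro l rfl u hl hr
      by_cases hd : (l.map Prod.fst).Nodup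
      · have hb := add_net_mem hf hd hr
        choose g hg using fun e => Int.eq_ofNat_of_zero_le (hb e).1
        have := hmin g (fun e => by have := (hb e).2; rw [hg] at this; exact_mod_cast this)
          (fun v => by
            have := hl.sum_net v
            simp only [← hg, Finset.sum_add_distrib]
            linarith)
        simp only [← hg, mul_add, Finset.sum_add_distrib, sum_mul_net] at this
        linarith
      · obtain ⟨w, m, k, hm, hk, h1, h2, h3, h4, h5⟩ := hl.split hd c
        rw [h5]
        exact add_nonneg (ih _ h1 m rfl u hm fun a ha => hr a (h3 ha))
          (ih _ h2 k rfl w hk fun a ha => hr a (h4 ha))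
  have bound : ∀ n, ∀ l : List (E × Bool), l.length = n → ∀ u v, IsWalk tail head u v l →
      (∀ a ∈ l, Residual cap f a) → -∑ e, |c e| ≤ cost c l := by
    intro n
    induction n using Nat.strong_induction_on with
    | _ n ih =>
      rintro l rfl u v hl hr
      by_cases hd : (l.map Prod.fst).Nodup
      · exact neg_sum_abs_le_cost c hd
      · obtain ⟨w, m, k, hm, hk, h1, -, h3, h4, h5⟩ := hl.split hd c
        have := ih _ h1 m rfl u v hm fun a ha => hr a (h3 ha)
        have := closed _ k rfl w hk fun a ha => hr a (h4 ha)
        linarith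
  -- The starting vertex is left free, so the empty walk makes every `S v` nonempty and no
  -- reachability is needed.
  let S : V → Set ℤ := fun v =>
    {x | ∃ u l, IsWalk tail head u v l ∧ (∀ a ∈ l, Residual cap f a) ∧ cost c l = x}
  have hne : ∀ v, (S v).Nonempty := fun v => ⟨0, v, [], rfl, by simp, by simp [cost]⟩
  have hbdd : ∀ v, BddBelow (S v) := by
    intro v
    refine ⟨-∑ e, |c e|, ?_⟩
    rintro _ ⟨u, l, hl, hr, rfl⟩
    exact bound _ l rfl u v hl hr
  have step : ∀ a, Residual cap f a →
      sInf (S (tgt tail head a)) ≤ sInf (S (src tail head a)) + sign a * c a.1 := by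
    intro a ha
    obtain ⟨u, l, hl, hr, hx⟩ := Int.csInf_mem (hne (src tail head a)) (hbdd _)
    refine csInf_le (hbdd _) ⟨u, l ++ [a], isWalk_append.2 ⟨_, hl, rfl, rfl⟩, ?_, ?_⟩
    · intro b hb
      rcases List.mem_append.1 hb with h | h
      · exact hr b h
      · rwa [List.mem_singleton.1 h]
    · rw [cost_append, hx, cost_cons]
      simp [cost]
  -- An unsaturated edge is residual forwards and an edge carrying flow is residual backwards; each
  -- gives one of the two inequalities.
  refine ⟨fun v => sInf (S v), fun e => ⟨fun h => ?_, fun h => ?_⟩⟩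
  · have := step (e, true) h
    simp only [src, tgt, sign, if_true] at this
    linarith
  · have := step (e, false) h
    simp only [src, tgt, sign, Bool.false_eq_true, if_false] at this
    linarith

end Arc

namespace Network

variable {V E : Type*} {N : Network V E} {δ : ℕ}

/-! ### Static flows and routes -/

/-- A route that starts outside a set of vertices and ends inside enters it. -/
theorem exists_mem_enter {S : V → Prop} {u v : V} {l : List E} (hl : IsPath N.tail N.head u v l)
    (hu : ¬ S u) (hv : S v) : ∃ e ∈ l, ¬ S (N.tail e) ∧ S (N.head e) := by
  induction l generalizing u with
  | nil => simp [IsPath] at hl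
  | cons e l ih =>
    obtain ⟨h1, h2, h3⟩ := hl
    obtain rfl : N.tail e = u := by simpa using h2
    by_cases h : S (N.head e)
    · exact ⟨e, List.mem_cons_self, hu, h⟩
    · cases l with
      | nil =>
        obtain rfl : N.head e = v := by simpa using h3
        exact absurd hv h
      | cons e' l =>
        rw [List.isChain_cons_cons] at h1
        obtain ⟨x, hx, hx'⟩ := ih ⟨h1.2, by simp [h1.1], by simpa using h3⟩ h
        exact ⟨x, List.mem_cons_of_mem _ hx, hx'⟩

/-- A potential difference along a path is the sum of the differences along its edges. -/
theorem sum_map_potential (π : V → ℤ) {u v : V} {l : List E}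
    (hl : IsPath N.tail N.head u v l) :
    (l.map fun e => π (N.head e) - π (N.tail e)).sum = π v - π u := by
  induction l generalizing u with
  | nil => simp [IsPath] at hl
  | cons e l ih =>
    obtain ⟨h1, h2, h3⟩ := hl
    obtain rfl : N.tail e = u := by simpa using h2
    cases l with
    | nil =>
      obtain rfl : N.head e = v := by simpa using h3
      simp
    | cons e' l =>
      rw [List.isChain_cons_cons] at h1
      have := ih (u := N.head e) ⟨h1.2, by simp [h1.1], by simpa using h3⟩
      rw [List.map_cons, List.sum_cons, this]
      ring

/-- A nonempty walk along forward arcs is a path. -/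
theorem isPath_of_isWalk {u v : V} {l : List (E × Bool)} (hl : Arc.IsWalk N.tail N.head u v l)
    (hf : ∀ a ∈ l, a.2 = true) (hne : l ≠ []) :
    IsPath N.tail N.head u v (l.map Prod.fst) := by
  induction l generalizing u with
  | nil => exact absurd rfl hne
  | cons a l ih =>
    have ha := hf a List.mem_cons_self
    obtain ⟨h1, h2⟩ := hl
    simp only [Arc.src, Arc.tgt, ha, if_true] at h1 h2
    cases l with
    | nil =>
      obtain rfl : N.head a.1 = v := h2
      simp [IsPath, h1]
    | cons b l =>
      have hb := hf b (by simp)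
      obtain ⟨h3, h4, h5⟩ := ih h2 (fun x hx => hf x (List.mem_cons_of_mem _ hx)) (by simp)
      refine ⟨?_, by simp [h1], by simpa using h5⟩
      rw [List.map_cons, List.map_cons, List.isChain_cons_cons]
      exact ⟨by simpa using h4.symm, h3⟩

/-! ### Existence and decomposition of feasible flows -/

variable [DecidableEq V] [Fintype E]

/-- The value of a flow is its net inflow into any set of vertices that separates the destination
from the source. -/
theorem IsFeasibleFlow.sum_enter [Fintype V] {f : E → ℕ} (hf : N.IsFeasibleFlow δ f) (S : V → Prop)
    [DecidablePred S] (hs : ¬ S N.source) (hd : S N.dest) :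
    ∑ e with S (N.head e) ∧ ¬ S (N.tail e), f e =
      δ + ∑ e with S (N.tail e) ∧ ¬ S (N.head e), f e := by
  have h1 : ∀ g : E → V, ∑ e with S (g e), f e = ∑ v with S v, ∑ e with g e = v, f e := by
    intro g
    rw [← Finset.sum_fiberwise_of_maps_to (s := Finset.univ.filter fun e => S (g e))
      (t := Finset.univ.filter fun v => S v) (g := g) (by simp)]
    refine Finset.sum_congr rfl fun v hv => Finset.sum_congr ?_ fun _ _ => rfl
    ext e
    simp only [Finset.mem_filter, Finset.mem_univ, true_and] at hv ⊢
    constructor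
    · exact fun h => h.2
    · rintro rfl
      exact ⟨hv, rfl⟩
  -- Conservation summed over `S`; only the destination is unbalanced, with inflow `δ` and no
  -- outgoing edge.
  have h2 : ∑ e with S (N.head e), f e = δ + ∑ e with S (N.tail e), f e := by
    rw [h1, h1]
    have hmem : N.dest ∈ Finset.univ.filter fun v => S v := by simpa using hd
    rw [← Finset.add_sum_erase _ _ hmem, ← Finset.add_sum_erase _ _ hmem, hf.value]
    have : ∑ e with N.tail e = N.dest, f e = 0 :=
      Finset.sum_eq_zero fun e he => absurd (Finset.mem_filter.1 he).2 (N.tail_ne_dest e)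
    rw [this, zero_add]
    congr 1
    refine Finset.sum_congr rfl fun v hv => hf.conserved v ?_ (Finset.ne_of_mem_erase hv)
    rintro rfl
    exact hs (by simpa using (Finset.mem_of_mem_erase hv))
  have h3 : ∀ g h : E → V, ∑ e with S (g e), f e =
      (∑ e with S (g e) ∧ S (h e), f e) + ∑ e with S (g e) ∧ ¬ S (h e), f e := by
    intro g h
    rw [← Finset.sum_filter_add_sum_filter_not _ (fun e => S (h e)), Finset.filter_filter,
      Finset.filter_filter]
  have h4 := h3 N.head N.tail
  have h5 := h3 N.tail N.head
  have h6 : ∑ e with S (N.head e) ∧ S (N.tail e), f e =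
      ∑ e with S (N.tail e) ∧ S (N.head e), f e := by simp only [and_comm]
  omega

/-- There is a min-cost flow of every value that is attained. -/
theorem exists_isMinCostFlow (h : ∃ f, N.IsFeasibleFlow δ f) : ∃ f, N.IsMinCostFlow δ f := by
  have hne : {x | ∃ f, N.IsFeasibleFlow δ f ∧ N.flowCost f = x}.Nonempty := by
    obtain ⟨f, hf⟩ := h
    exact ⟨_, f, hf, rfl⟩
  obtain ⟨f, hf, hx⟩ := Nat.sInf_mem hne
  exact ⟨f, hf, fun g hg => hx ▸ Nat.sInf_le ⟨g, hg, rfl⟩⟩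

/-- A positive flow contains a route that uses each edge at most once. -/
theorem IsFeasibleFlow.exists_route [Fintype V] {f : E → ℕ} (hf : N.IsFeasibleFlow δ f) (hδ : 0 < δ) :
    ∃ r : N.Route, r.edges.Nodup ∧ ∀ e ∈ r.edges, 0 < f e := by
  classical
  let P : E × Bool → Prop := fun a => a.2 = true ∧ 0 < f a.1
  let R : V → Prop := fun v =>
    ∃ l, Arc.IsWalk N.tail N.head N.source v l ∧ ∀ a ∈ l, P a
  by_cases hR : R N.dest
  · obtain ⟨l, hl, hr⟩ := hR
    obtain ⟨m, hm, hml, hd⟩ := hl.exists_nodup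
    have hne : m ≠ [] := by
      rintro rfl
      exact N.source_ne_dest hm
    refine ⟨⟨m.map Prod.fst, isPath_of_isWalk hm (fun a ha => (hr a (hml ha)).1) hne⟩, hd, ?_⟩
    intro e he
    obtain ⟨a, ha, rfl⟩ := List.mem_map.1 he
    exact (hr a (hml ha)).2
  · exfalso
    have hs : R N.source := ⟨[], rfl, by simp⟩
    -- The vertices not reached along positive flow would have to receive at least `δ > 0`, yet no
    -- flow enters them.
    have key := hf.sum_enter (fun v => ¬ R v) (by simpa using hs) hR
    have : ∑ e with ¬ R (N.head e) ∧ ¬¬ R (N.tail e), f e = 0 := by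
      refine Finset.sum_eq_zero fun e he => ?_
      obtain ⟨-, h1, h2⟩ := Finset.mem_filter.1 he
      by_contra hc
      obtain ⟨l, hl, hr⟩ := not_not.1 h2
      refine h1 ⟨l ++ [(e, true)], Arc.isWalk_append.2 ⟨_, hl, rfl, rfl⟩, fun b hb => ?_⟩
      rcases List.mem_append.1 hb with h | h
      · exact hr b h
      · rw [List.mem_singleton.1 h]
        exact ⟨rfl, Nat.pos_of_ne_zero hc⟩
    omega

variable [DecidableEq E]

/-- A flow stays feasible if a unit of flow is sent from the source to the destination along a
residual walk. -/
theorem IsFeasibleFlow.augment {f : E → ℕ} (hf : N.IsFeasibleFlow δ f) {l : List (E × Bool)}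
    (hl : Arc.IsWalk N.tail N.head N.source N.dest l) (hd : (l.map Prod.fst).Nodup)
    (hr : ∀ a ∈ l, Arc.Residual N.cap f a) : ∃ g, N.IsFeasibleFlow (δ + 1) g := by
  have hb := Arc.add_net_mem hf.le_cap hd hr
  choose g hg using fun e => Int.eq_ofNat_of_zero_le (hb e).1
  refine ⟨g, ⟨fun e => ?_, fun v h1 h2 => ?_, ?_⟩⟩
  · have := (hb e).2
    rw [hg] at this
    exact_mod_cast this
  · have h3 := hl.sum_net v
    rw [if_neg (Ne.symm h1), if_neg (Ne.symm h2)] at h3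
    have h4 := hf.conserved v h1 h2
    zify at h4 ⊢
    simp only [← hg, Finset.sum_add_distrib]
    linarith
  · have h3 := hl.sum_net N.dest
    rw [if_pos rfl, if_neg N.source_ne_dest] at h3
    have h4 := hf.value
    have h5 : ∑ e with N.tail e = N.dest, Arc.net l e = 0 :=
      Finset.sum_eq_zero fun e he => absurd (Finset.mem_filter.1 he).2 (N.tail_ne_dest e)
    zify at h4 ⊢
    simp only [← hg, Finset.sum_add_distrib]
    linarith

/-- **Max-flow min-cut**: every value up to the capacity of the network is attained. -/
theorem exists_isFeasibleFlow [Fintype V] (hδ : δ ≤ N.capacity) : ∃ f, N.IsFeasibleFlow δ f := by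
  classical
  induction δ with
  | zero => exact ⟨0, by simp, by simp, by simp⟩
  | succ δ ih =>
    obtain ⟨f, hf⟩ := ih (by omega)
    let R : V → Prop := fun v =>
      ∃ l, Arc.IsWalk N.tail N.head N.source v l ∧ ∀ a ∈ l, Arc.Residual N.cap f a
    by_cases hR : R N.dest
    · obtain ⟨l, hl, hr⟩ := hR
      obtain ⟨m, hm, hml, hd⟩ := hl.exists_nodup
      exact hf.augment hm hd fun a ha => hr a (hml ha)
    have step : ∀ a, Arc.Residual N.cap f a → R (Arc.src N.tail N.head a) →
        R (Arc.tgt N.tail N.head a) := by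
      rintro a ha ⟨l, hl, hr⟩
      refine ⟨l ++ [a], Arc.isWalk_append.2 ⟨_, hl, rfl, rfl⟩, fun b hb => ?_⟩
      rcases List.mem_append.1 hb with h | h
      · exact hr b h
      · rwa [List.mem_singleton.1 h]
    have hs : R N.source := ⟨[], rfl, by simp⟩
    -- No residual arc leaves `R`: edges out of `R` are saturated and edges into `R` are empty.
    -- Hence the cut of edges leaving `R` has capacity `δ`, against `δ + 1 ≤ N.capacity`.
    have key := hf.sum_enter (fun v => ¬ R v) (by simpa using hs) hR
    have h0 : ∑ e with ¬ R (N.tail e) ∧ ¬¬ R (N.head e), f e = 0 := by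
      refine Finset.sum_eq_zero fun e he => ?_
      obtain ⟨-, h1, h2⟩ := Finset.mem_filter.1 he
      by_contra hc
      exact h1 (step (e, false) (Nat.pos_of_ne_zero hc) (not_not.1 h2))
    have h1 : ∑ e with ¬ R (N.head e) ∧ ¬¬ R (N.tail e), f e =
        ∑ e with ¬ R (N.head e) ∧ ¬¬ R (N.tail e), N.cap e := by
      refine Finset.sum_congr rfl fun e he => le_antisymm (hf.le_cap e) ?_
      obtain ⟨-, h1, h2⟩ := Finset.mem_filter.1 he
      by_contra hc
      exact h1 (step (e, true) (not_le.1 hc) (not_not.1 h2))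
    have hcut : N.IsCut (Finset.univ.filter fun e => ¬ R (N.head e) ∧ ¬¬ R (N.tail e)) := by
      intro r
      obtain ⟨e, he, h2, h3⟩ := exists_mem_enter (S := fun v => ¬ R v) r.2 (by simpa using hs) hR
      exact ⟨e, by simpa using ⟨h3, not_not.1 h2⟩, he⟩
    have : N.capacity ≤ ∑ e with ¬ R (N.head e) ∧ ¬¬ R (N.tail e), N.cap e :=
      Nat.sInf_le ⟨_, hcut, rfl⟩
    omega

/-- A unit of flow along a route is conserved. -/
theorem Route.sum_count (r : N.Route) (v : V) :
    ((∑ e with N.head e = v, r.edges.count e : ℕ) : ℤ) - (∑ e with N.tail e = v, r.edges.count e : ℕ)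
      = (if N.dest = v then 1 else 0) - (if N.source = v then 1 else 0) := by
  have h1 : ∀ g : E → V, ((∑ e with g e = v, r.edges.count e : ℕ) : ℤ) =
      (r.edges.map fun e => if g e = v then (1 : ℤ) else 0).sum := by
    intro g
    induction r.edges with
    | nil => simp
    | cons a l ih =>
      rw [List.map_cons, List.sum_cons, ← ih]
      simp only [List.count_cons, Finset.sum_add_distrib, beq_iff_eq, Finset.sum_ite_eq]
      simp [add_comm]
  -- The right-hand side is the difference along the route of the potential that is the indicator of
  -- `v`.
  rw [h1, h1, ← sum_map_potential (fun w => if w = v then (1 : ℤ) else 0) r.2]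
  unfold Route.edges
  induction r.1 with
  | nil => simp
  | cons a l ih =>
    simp only [List.map_cons, List.sum_cons]
    linarith

/-- Every feasible flow contains one of the same value that has a route decomposition. -/
theorem IsFeasibleFlow.exists_isRouteDecomposition [Fintype V] {f : E → ℕ}
    (hf : N.IsFeasibleFlow δ f) :
    ∃ (g : E → ℕ) (F : N.Route →₀ ℕ), N.IsFeasibleFlow δ g ∧ (∀ e, g e ≤ f e) ∧
      N.IsRouteDecomposition δ F g := by
  induction δ generalizing f with
  | zero =>
    -- Here `f` may still be a nonzero circulation, which routes need not account for; it is
    -- dropped.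
    exact ⟨0, 0, ⟨by simp, by simp, by simp⟩, by simp, by simp [IsRouteDecomposition]⟩
  | succ δ ih =>
    obtain ⟨r, hd, hpos⟩ := hf.exists_route (Nat.succ_pos δ)
    -- Since `r` repeats no edge, one unit of positive flow per edge suffices, and the natural
    -- subtraction below never truncates.
    have hle : ∀ e, r.edges.count e ≤ f e := by
      intro e
      by_cases he : e ∈ r.edges
      · exact le_trans (List.nodup_iff_count_le_one.1 hd e) (hpos e he)
      · simp [List.count_eq_zero_of_not_mem he]
    have hsub : ∀ s : Finset E, ((∑ e ∈ s, (f e - r.edges.count e) : ℕ) : ℤ) =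
        (∑ e ∈ s, f e : ℕ) - (∑ e ∈ s, r.edges.count e : ℕ) := by
      intro s
      have : ∑ e ∈ s, (f e - r.edges.count e) + ∑ e ∈ s, r.edges.count e = ∑ e ∈ s, f e := by
        rw [← Finset.sum_add_distrib]
        exact Finset.sum_congr rfl fun e _ => Nat.sub_add_cancel (hle e)
      omega
    have hf' : N.IsFeasibleFlow δ fun e => f e - r.edges.count e := by
      refine ⟨fun e => le_trans (Nat.sub_le _ _) (hf.le_cap e), fun v h1 h2 => ?_, ?_⟩
      · have h3 := r.sum_count v
        rw [if_neg (Ne.symm h1), if_neg (Ne.symm h2)] at h3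
        have h4 := hf.conserved v h1 h2
        zify at h4
        have h5 := hsub (Finset.univ.filter fun e => N.head e = v)
        have h6 := hsub (Finset.univ.filter fun e => N.tail e = v)
        push_cast at *
        linarith
      · have h3 := r.sum_count N.dest
        rw [if_pos rfl, if_neg N.source_ne_dest] at h3
        have h4 := hf.value
        have h7 : ∑ e with N.tail e = N.dest, r.edges.count e = 0 :=
          Finset.sum_eq_zero fun e he => absurd (Finset.mem_filter.1 he).2 (N.tail_ne_dest e)
        have h5 := hsub (Finset.univ.filter fun e => N.head e = N.dest)
        zify at h4 h7 ⊢
        push_cast at *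
        linarith
    obtain ⟨g, F, hg, hgf, hF⟩ := ih hf'
    have hgr : ∀ e, g e + r.edges.count e ≤ f e := by
      intro e
      have := hgf e
      have := hle e
      omega
    refine ⟨fun e => g e + r.edges.count e, F + Finsupp.single r 1, ⟨fun e =>
      le_trans (hgr e) (hf.le_cap e), fun v h1 h2 => ?_, ?_⟩, hgr, ?_, fun e => ?_⟩
    · have h3 := r.sum_count v
      rw [if_neg (Ne.symm h1), if_neg (Ne.symm h2)] at h3
      have h4 := hg.conserved v h1 h2
      simp only [Finset.sum_add_distrib]
      omega
    · have h3 := r.sum_count N.dest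
      rw [if_pos rfl, if_neg N.source_ne_dest] at h3
      have h4 := hg.value
      have h7 : ∑ e with N.tail e = N.dest, r.edges.count e = 0 :=
        Finset.sum_eq_zero fun e he => absurd (Finset.mem_filter.1 he).2 (N.tail_ne_dest e)
      simp only [Finset.sum_add_distrib]
      omega
    · rw [Finsupp.sum_add_index (by simp) (by simp), hF.1]
      simp
    · rw [Finsupp.sum_add_index (by simp) (by simp [add_mul]), ← hF.2]
      simp

/-- There is a min-cost flow with a route decomposition. -/
theorem exists_isMinCostFlow_isRouteDecomposition [Fintype V] (hδ : δ ≤ N.capacity) :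
    ∃ (f : E → ℕ) (F : N.Route →₀ ℕ), N.IsMinCostFlow δ f ∧ N.IsRouteDecomposition δ F f := by
  obtain ⟨f, hf, hmin⟩ := exists_isMinCostFlow (exists_isFeasibleFlow hδ)
  obtain ⟨g, F, hg, hgf, hF⟩ := hf.exists_isRouteDecomposition
  refine ⟨g, F, ⟨hg, fun h hh => le_trans ?_ (hmin h hh)⟩, hF⟩
  exact Finset.sum_le_sum fun e _ => Nat.mul_le_mul_left _ (hgf e)

/-- Potentials that certify that a flow is min-cost. -/
theorem IsMinCostFlow.exists_potential {f : E → ℕ} (hf : N.IsMinCostFlow δ f) :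
    ∃ π : V → ℤ, ∀ e, (f e < N.cap e → 0 ≤ N.transit e + π (N.tail e) - π (N.head e)) ∧
      (0 < f e → N.transit e + π (N.tail e) - π (N.head e) ≤ 0) := by
  refine Arc.exists_potential hf.1.le_cap (fun e => (N.transit e : ℤ)) fun g hg hdiv => ?_
  have : N.IsFeasibleFlow δ g := by
    refine ⟨hg, fun v h1 h2 => ?_, ?_⟩
    · have h3 := hdiv v
      have h4 := hf.1.conserved v h1 h2
      zify at h4 ⊢
      linarith
    · have h3 := hdiv N.dest
      have h4 := hf.1.value
      -- No edge leaves the destination, so equal divergence there means equal value.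
      have h5 : ∀ h : E → ℕ, ∑ e with N.tail e = N.dest, (h e : ℤ) = 0 := fun h =>
        Finset.sum_eq_zero fun e he => absurd (Finset.mem_filter.1 he).2 (N.tail_ne_dest e)
      rw [h5, h5] at h3
      zify at h4 ⊢
      linarith
  have := hf.2 g this
  unfold flowCost at this
  exact_mod_cast this

end Network

namespace Network

variable {V E : Type*} {N : Network V E} {δ : ℕ}

/-! ### Sums over routes -/

theorem sum_map_eq_sum_count [Fintype E] [DecidableEq E] {M : Type*} [AddCommMonoid M] (l : List E)
    (h : E → M) : (l.map h).sum = ∑ e, l.count e • h e := by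
  rw [Finset.sum_list_map_count]
  refine Finset.sum_subset (Finset.subset_univ _) fun e _ he => ?_
  rw [List.count_eq_zero_of_not_mem (by simpa using he), zero_smul]

theorem card_filter_getElem? [DecidableEq E] {l : List E} {n : ℕ} (h : l.length ≤ n) (e : E) :
    ((Finset.range n).filter fun k => l[k]? = some e).card = l.count e := by
  rw [Finset.card_filter]
  induction l generalizing n with
  | nil => simp
  | cons a l ih =>
    obtain ⟨m, rfl⟩ : ∃ m, n = m + 1 := ⟨n - 1, by simp at h; omega⟩
    rw [Finset.sum_range_succ']
    simp only [List.getElem?_cons_succ, List.getElem?_cons_zero, List.count_cons, beq_iff_eq,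
      Option.some.injEq]
    rw [ih (by simpa using h)]

/-- A flow over routes is realized by an assignment of routes to the players of a generation. -/
theorem exists_assignment [DecidableEq E] (F : N.Route →₀ ℕ) (hF : (F.sum fun _ n => n) = δ) :
    ∃ ρ : Fin δ → N.Route, ∀ r, (Finset.univ.filter fun i => ρ i = r).card = F r := by
  classical
  -- List each route `r` with multiplicity `F r`; player `i` takes the `i`-th entry.
  let m := Finsupp.toMultiset F
  have hm : m.toList.length = δ := by
    rw [Multiset.length_toList, Finsupp.card_toMultiset, ← hF]
    rfl
  refine ⟨fun i => m.toList.get (i.cast hm.symm), fun r => ?_⟩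
  subst hm
  have h1 : F r = m.toList.count r := by
    rw [← Multiset.coe_count, Multiset.coe_toList, Finsupp.count_toMultiset]
  rw [h1]
  conv_rhs => rw [← List.ofFn_get m.toList]
  rw [← Multiset.coe_count, ← Fin.univ_val_map, Multiset.count_map]
  simp only [Finset.card_def, Finset.filter_val, eq_comm]
  rfl

theorem sum_assignment [DecidableEq E] {F : N.Route →₀ ℕ} {ρ : Fin δ → N.Route}
    (hρ : ∀ r, (Finset.univ.filter fun i => ρ i = r).card = F r) (h : N.Route → ℕ) :
    ∑ i, h (ρ i) = F.sum fun r n => n * h r := by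
  classical
  rw [Finsupp.sum, ← Finset.sum_fiberwise_of_maps_to (s := Finset.univ) (t := F.support) (g := ρ)]
  · refine Finset.sum_congr rfl fun r _ => ?_
    rw [Finset.sum_congr rfl (g := fun _ => h r) fun i hi => by rw [(Finset.mem_filter.1 hi).2],
      Finset.sum_const, hρ, smul_eq_mul]
  · intro i _
    rw [Finsupp.mem_support_iff, ← hρ, Finset.card_ne_zero]
    exact ⟨i, by simp⟩

/-- The flow over edges induced by an assignment of routes. -/
theorem IsRouteDecomposition.sum_count [DecidableEq E] {F : N.Route →₀ ℕ} {f : E → ℕ}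
    (hF : N.IsRouteDecomposition δ F f) {ρ : Fin δ → N.Route}
    (hρ : ∀ r, (Finset.univ.filter fun i => ρ i = r).card = F r) (e : E) :
    ∑ i, (ρ i).edges.count e = f e := by
  rw [hF.2, sum_assignment hρ fun r => r.edges.count e]

/-- The total over an assignment of a cost that is additive along routes. -/
theorem IsRouteDecomposition.sum_sum_map [Fintype E] [DecidableEq E] {F : N.Route →₀ ℕ} {f : E → ℕ}
    (hF : N.IsRouteDecomposition δ F f) {ρ : Fin δ → N.Route}
    (hρ : ∀ r, (Finset.univ.filter fun i => ρ i = r).card = F r) {M : Type*} [AddCommMonoid M]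
    (h : E → M) : ∑ i, ((ρ i).edges.map h).sum = ∑ e, f e • h e := by
  simp only [sum_map_eq_sum_count]
  rw [Finset.sum_comm]
  simp only [← Finset.sum_smul, hF.sum_count hρ]

/-! ### Profiles without queues -/

/-- The stage at which `p` has passed `k` edges if she never waits. -/
def freeRun (σ : N.Profile δ) (p : Player δ) (k : ℕ) : ℕ :=
  p.departure + (((σ p).edges.take k).map N.transit).sum

theorem freeRun_succ (σ : N.Profile δ) {p : Player δ} {k : ℕ} {e : E}
    (he : (σ p).edges[k]? = some e) : freeRun σ p (k + 1) = freeRun σ p k + N.transit e := by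
  simp [freeRun, List.take_add_one, he, add_assoc]

/-- If never more than `γ_e` passages enter the edge `e` at the same stage of the run without
waiting, then that is the course of the network. -/
theorem isRun_freeRun {σ : N.Profile δ}
    (h : ∀ e a, {v : Player δ × ℕ | (σ v.1).edges[v.2]? = some e ∧
      freeRun σ v.1 v.2 = a}.encard ≤ N.cap e) :
    IsRun σ fun p k => (freeRun σ p k : ℕ∞) := by
  refine ⟨fun p => by simp [freeRun], fun p k e he => ?_, fun p k he => ?_⟩
  · have hcan : CanExit σ (fun p k => (freeRun σ p k : ℕ∞)) p k e (freeRun σ p (k + 1)) := by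
      refine ⟨by rw [freeRun_succ σ he]; exact_mod_cast le_rfl, ?_⟩
      refine lt_of_lt_of_le ?_ (h e (freeRun σ p k))
      -- Without waiting, everyone spends the same time on `e`, so those ahead and not yet gone
      -- entered at the same stage as `(p, k)`. That set also contains `(p, k)`, which is not ahead
      -- of itself: hence the strict inequality.
      apply Set.Finite.encard_lt_encard
      · refine Set.Finite.subset (Set.finite_of_encard_le_coe (h e (freeRun σ p k))) ?_
        rintro ⟨q, j⟩ ⟨h1, h2, h3⟩
        refine ⟨h1, ?_⟩
        dsimp only at h1 h2 h3 ⊢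
        rw [freeRun_succ σ h1, freeRun_succ σ he] at h3
        norm_cast at h2 h3
        omega
      · rw [Set.ssubset_iff_of_subset]
        · refine ⟨(p, k), ⟨he, rfl⟩, ?_⟩
          rintro ⟨-, h2, -⟩
          simp at h2
        · rintro ⟨q, j⟩ ⟨h1, h2, h3⟩
          refine ⟨h1, ?_⟩
          dsimp only at h1 h2 h3 ⊢
          rw [freeRun_succ σ h1, freeRun_succ σ he] at h3
          norm_cast at h2 h3
          omega
    apply le_antisymm
    · refine le_sInf ?_
      rintro _ ⟨n, ⟨h1, -⟩, rfl⟩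
      dsimp only at h1 ⊢
      rw [freeRun_succ σ he]
      exact_mod_cast h1
    · exact sInf_le ⟨_, hcan, rfl⟩
  · rw [List.getElem?_eq_none_iff] at he
    simp [freeRun, List.take_of_length_le he, List.take_of_length_le (Nat.le_succ_of_le he)]

theorem latency_eq_transitCost {σ : N.Profile δ} {p : Player δ} (h : ∀ k, edgeWait σ p k = 0) :
    latency σ p = transitCost σ p := by
  simp [latency, waitingCost, h]

/-- If every generation uses the same assignment of routes, which obeys the capacities of the edges,
then nobody ever waits. -/
theorem edgeWait_eq_zero [DecidableEq E] {ρ : Fin δ → N.Route}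
    (hρ : ∀ e, ∑ i, (ρ i).edges.count e ≤ N.cap e) (p : Player δ)
    (k : Fin (ρ (ofLex p).2).edges.length) :
    edgeWait (fun p : Player δ => ρ (ofLex p).2) p k = 0 := by
  have hrun := isRun_freeRun (σ := fun p : Player δ => ρ (ofLex p).2) fun e a => by
    let A : Finset (Σ _ : Fin δ, ℕ) := Finset.univ.sigma fun i =>
      (Finset.range (ρ i).edges.length).filter fun k => (ρ i).edges[k]? = some e
    have hA : A.card ≤ N.cap e := by
      refine le_trans (le_of_eq ?_) (hρ e)
      rw [Finset.card_sigma]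
      refine Finset.sum_congr rfl fun i _ => ?_
      exact card_filter_getElem? le_rfl e
    refine le_trans (le_trans (Set.encard_le_encard_of_injOn (t := (A : Set (Σ _ : Fin δ, ℕ)))
      (f := fun v => ⟨(ofLex v.1).2, v.2⟩) ?_ ?_) (le_of_eq (Set.encard_coe_eq_coe_finsetCard A)))
      (by exact_mod_cast hA)
    · rintro ⟨q, j⟩ ⟨h1, -⟩
      have := (List.getElem?_eq_some_iff.1 h1).1
      simp only [A, Finset.mem_coe, Finset.mem_sigma, Finset.mem_univ, true_and, Finset.mem_filter,
        Finset.mem_range]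
      exact ⟨this, h1⟩
    -- Equal rank means equal route, so after equally many edges the same stage forces the same
    -- departure.
    · rintro ⟨q, j⟩ ⟨-, h1⟩ ⟨q', j'⟩ ⟨-, h2⟩ h
      simp only [Sigma.mk.injEq, heq_eq_eq] at h
      obtain ⟨h3, rfl⟩ := h
      simp only [freeRun, h3] at h1 h2
      have : (ofLex q).1 = (ofLex q').1 := by
        simp only [Player.departure] at h1 h2
        omega
      have : ofLex q = ofLex q' := Prod.ext this h3
      simpa using this
  rw [edgeWait, (isRun_run _).unique hrun]
  dsimp only
  rw [freeRun_succ (e := (ρ (ofLex p).2).edges[k]) _ (by simp)]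
  simp

end Network

namespace Network

variable {V E : Type*} {N : Network V E} {δ : ℕ}

/-! ### The lower bound on the latency -/

/-- At each stage at most `γ_e` passages exit the edge `e`. -/
theorem card_exits_le (σ : N.Profile δ) (e : E) (n : ℕ) (S : Finset (Player δ × ℕ))
    (hS : ∀ v ∈ S, (σ v.1).edges[v.2]? = some e ∧ run σ v.1 (v.2 + 1) = n) :
    S.card ≤ N.cap e := by
  classical
  rcases S.eq_empty_or_nonempty with rfl | hne
  · simp
  -- Queue order: entry stage, then priority, then passage. When the last passage of `S` exits, all
  -- the others are still ahead of it, so they number less than `γ_e`.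
  let φ : Player δ × ℕ → ℕ∞ ×ₗ Player δ ×ₗ ℕ := fun v => toLex (run σ v.1 v.2, toLex v)
  obtain ⟨v, hv, hmax⟩ := S.exists_max_image φ hne
  obtain ⟨he, hx⟩ := hS v hv
  have hcan : CanExit σ (run σ) v.1 v.2 e n := by
    rw [(isRun_run σ).step v.1 v.2 e he] at hx
    obtain ⟨m, hm, hmn⟩ := sInf_coe_le.1 hx.le
    have : (n : ℕ∞) ≤ m := hx ▸ sInf_le ⟨m, hm, rfl⟩
    rwa [le_antisymm hmn (by exact_mod_cast this)] at hm
  have hsub : (↑(S.erase v) : Set (Player δ × ℕ)) ⊆ ahead σ (run σ) v.1 v.2 e n := by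
    intro w hw
    obtain ⟨hwv, hw⟩ := Finset.mem_erase.1 hw
    obtain ⟨h1, h2⟩ := hS w hw
    refine ⟨h1, ?_, h2.ge⟩
    have hlt : φ w < φ v := by
      refine lt_of_le_of_ne (hmax w hw) fun h => hwv ?_
      have h3 := (Prod.mk.injEq .. ▸ toLex_inj.1 h).2
      exact toLex_inj.1 h3
    simpa [φ, Prod.Lex.toLex_lt_toLex] using hlt
  have h1 := lt_of_le_of_lt (Set.encard_le_encard hsub) hcan.2
  rw [Set.encard_coe_eq_coe_finsetCard] at h1
  have h2 : (S.erase v).card < N.cap e := by exact_mod_cast h1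
  have h3 := Finset.card_erase_add_one hv
  omega

/-- A player has left her route by the end of her latency. -/
theorem run_le_departure_add_latency (σ : N.Profile δ) (p : Player δ) {k : ℕ}
    (hk : k ≤ (σ p).edges.length) : run σ p k ≤ p.departure + latency σ p := by
  let w : ℕ → ℕ∞ := fun j =>
    if h : j < (σ p).edges.length then N.transit (σ p).edges[j] + edgeWait σ p ⟨j, h⟩ else 0
  have hw : latency σ p = ∑ j ∈ Finset.range (σ p).edges.length, w j := by
    rw [Finset.sum_range, latency, transitCost, waitingCost, ← Fin.sum_univ_fun_getElem]
    push_cast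
    rw [← Finset.sum_add_distrib]
    refine Finset.sum_congr rfl fun j _ => ?_
    simp [w]
  have hrun : ∀ k ≤ (σ p).edges.length,
      run σ p k ≤ p.departure + ∑ j ∈ Finset.range k, w j := by
    intro k
    induction k with
    | zero => simp [(isRun_run σ).start p]
    | succ k ih =>
      intro hk
      have hk' : k < (σ p).edges.length := hk
      rw [Finset.sum_range_succ, ← add_assoc]
      refine le_trans ?_ (add_le_add_left (ih hk'.le) _)
      simp only [w, dif_pos hk', edgeWait]
      rw [← add_assoc]
      exact le_add_tsub
  refine le_trans (hrun k hk) (add_le_add_right ?_ _)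
  rw [hw]
  exact Finset.sum_le_sum_of_subset (Finset.range_mono hk)

theorem transitCost_le_latency (σ : N.Profile δ) (p : Player δ) :
    (transitCost σ p : ℕ∞) ≤ latency σ p := le_self_add

/-! ### Prices and duality -/

/-- The excess of a potential difference over the transit cost of an edge: the price of a unit of
its capacity. -/
def price (N : Network V E) (π : V → ℤ) (e : E) : ℕ :=
  (π (N.head e) - π (N.tail e) - N.transit e).toNat

/-- The potential difference is at most the transit cost and the prices along a route. -/
theorem potential_le_transitCost_add [Fintype E] [DecidableEq E] (σ : N.Profile δ) (π : V → ℤ)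
    (p : Player δ) : π N.dest - π N.source ≤
      transitCost σ p + ∑ e, (((σ p).edges.count e * N.price π e : ℕ) : ℤ) := by
  rw [← sum_map_potential π (σ p).2, ← Nat.cast_sum]
  have : ∑ e, (σ p).edges.count e * N.price π e = ((σ p).edges.map (N.price π)).sum := by
    simp [sum_map_eq_sum_count]
  rw [this, transitCost, ← Nat.cast_add, ← List.sum_map_add, Nat.cast_list_sum, List.map_map]
  refine List.sum_le_sum fun e _ => ?_
  simp only [Function.comp_apply, price]
  push_cast
  have := Int.self_le_toNat (π (N.head e) - π (N.tail e) - N.transit e)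
  linarith

/-- The players of the first `T` generations. -/
def firstPlayers (δ T : ℕ) : Finset (Player δ) :=
  (Finset.range T ×ˢ (Finset.univ : Finset (Fin δ))).map toLex.toEmbedding

theorem sum_totalLatency (σ : N.Profile δ) (T : ℕ) :
    ∑ t ∈ Finset.range T, totalLatency σ t = ∑ p ∈ firstPlayers δ T, latency σ p := by
  rw [firstPlayers, Finset.sum_map, Finset.sum_product]
  rfl

theorem departure_lt {T : ℕ} {p : Player δ} (hp : p ∈ firstPlayers δ T) : p.departure < T := by
  obtain ⟨x, hx, rfl⟩ := Finset.mem_map.1 hp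
  exact Finset.mem_range.1 (Finset.mem_product.1 hx).1

/-- Among the first `T` generations, the players of latency less than `M` pass an edge at most
`γ_e (T + M)` times. -/
theorem sum_count_le [DecidableEq E] (σ : N.Profile δ) (e : E) (T M : ℕ) (A : Finset (Player δ))
    (hA : ∀ p ∈ A, p.departure < T ∧ latency σ p < M) :
    ∑ p ∈ A, (σ p).edges.count e ≤ N.cap e * (T + M) := by
  let B := A.sup fun p => (σ p).edges.length
  let S := (A ×ˢ Finset.range B).filter fun v => (σ v.1).edges[v.2]? = some e
  have hS : ∑ p ∈ A, (σ p).edges.count e = S.card := by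
    rw [Finset.card_filter, Finset.sum_product]
    refine Finset.sum_congr rfl fun p hp => ?_
    rw [← card_filter_getElem? (Finset.le_sup (f := fun p => (σ p).edges.length) hp) e,
      Finset.card_filter]
  have hexit : ∀ v ∈ S, ∃ n < T + M, run σ v.1 (v.2 + 1) = (n : ℕ) := by
    intro v hv
    obtain ⟨h1, h2⟩ := Finset.mem_filter.1 hv
    obtain ⟨h3, h4⟩ := hA v.1 (Finset.mem_product.1 h1).1
    have h5 := run_le_departure_add_latency σ v.1 (k := v.2 + 1)
      (List.getElem?_eq_some_iff.1 h2).1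
    obtain ⟨m, hm⟩ := ENat.ne_top_iff_exists.1 (ne_top_of_lt h4)
    rw [← hm] at h4 h5
    obtain ⟨n, hn⟩ := ENat.ne_top_iff_exists.1
      (ne_top_of_le_ne_top (by exact_mod_cast ENat.natCast_ne_top (v.1.departure + m)) h5)
    rw [← hn] at h5
    norm_cast at h4 h5
    exact ⟨n, by omega, hn.symm⟩
  rw [hS]
  conv_rhs => rw [← Finset.card_range (T + M)]
  -- All these exits happen at finite stages below `T + M`, so `toNat` loses nothing; each fibre is
  -- the set of exits at one stage.
  refine Finset.card_le_mul_card_image_of_maps_to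
    (f := fun v => (run σ v.1 (v.2 + 1)).toNat) ?_ _ fun n _ => ?_
  · intro v hv
    obtain ⟨n, hn, h⟩ := hexit v hv
    simpa [h] using hn
  · refine card_exits_le σ e n _ fun v hv => ?_
    obtain ⟨h1, h2⟩ := Finset.mem_filter.1 hv
    obtain ⟨m, -, h⟩ := hexit v h1
    refine ⟨(Finset.mem_filter.1 h1).2, ?_⟩
    rw [h] at h2 ⊢
    simpa using h2

/-- **Weak duality over time**: for every potential, the total latency of the first `T` generations
is, up to a constant, at least `T` times the value of the dual of the min-cost flow problem. -/
theorem dual_le_sum_totalLatency [Fintype E] (N : Network V E) (δ : ℕ) (π : V → ℤ) {C : ℕ}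
    (hC : (C : ℤ) = δ * (π N.dest - π N.source) - ∑ e, ((N.cap e * N.price π e : ℕ) : ℤ)) :
    ∃ K : ℕ, ∀ (σ : N.Profile δ) (T : ℕ),
      ((T * C : ℕ) : ℕ∞) ≤ ∑ t ∈ Finset.range T, totalLatency σ t + K := by
  classical
  set Δ := π N.dest - π N.source with hΔ
  let M := Δ.toNat
  refine ⟨M * ∑ e, N.cap e * N.price π e, fun σ T => ?_⟩
  set Q := firstPlayers δ T
  let A := Q.filter fun p => latency σ p < M
  -- Slow players, who may never leave the network, are charged only `M ≥ Δ`. That suffices without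
  -- any edge prices, so capacity has to be counted for the fast players alone.
  let b : Player δ → ℕ := fun p => if latency σ p < M then transitCost σ p else M
  have hb : ((∑ p ∈ Q, b p : ℕ) : ℕ∞) ≤ ∑ t ∈ Finset.range T, totalLatency σ t := by
    rw [sum_totalLatency, Nat.cast_sum]
    refine Finset.sum_le_sum fun p _ => ?_
    simp only [b]
    split_ifs with h
    · exact transitCost_le_latency σ p
    · exact not_lt.1 h
  refine le_trans ?_ (add_le_add_left hb _)
  have hQ : Q.card = T * δ := by simp [Q, firstPlayers]
  have h1 : ∀ p ∈ Q, Δ ≤ b p +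
      ∑ e, (((if latency σ p < M then (σ p).edges.count e else 0) * N.price π e : ℕ) : ℤ) := by
    intro p _
    simp only [b]
    split_ifs with h
    · exact potential_le_transitCost_add σ π p
    · simp [M]
  have h2 := Finset.sum_le_sum h1
  rw [Finset.sum_const, hQ, Finset.sum_add_distrib, Finset.sum_comm] at h2
  have h3 : ∀ e, ∑ p ∈ Q,
      (((if latency σ p < M then (σ p).edges.count e else 0) * N.price π e : ℕ) : ℤ) ≤
        ((N.cap e * N.price π e : ℕ) : ℤ) * (T + M) := by
    intro e
    have := sum_count_le σ e T M A fun p hp =>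
      ⟨departure_lt (Finset.mem_filter.1 hp).1, (Finset.mem_filter.1 hp).2⟩
    rw [Finset.sum_filter] at this
    rw [← Nat.cast_sum, ← Finset.sum_mul]
    have := Nat.mul_le_mul_right (N.price π e) this
    zify at this ⊢
    push_cast at *
    linarith
  have h4 := Finset.sum_le_sum fun e (_ : e ∈ Finset.univ) => h3 e
  rw [← Finset.sum_mul] at h4
  have h5 : ((T * C : ℕ) : ℤ) ≤
      ((∑ p ∈ Q, b p + M * ∑ e, N.cap e * N.price π e : ℕ) : ℤ) := by
    simp only [nsmul_eq_mul] at h2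
    have h6 : ((T * C : ℕ) : ℤ) = T * (δ * Δ - ∑ e, ((N.cap e * N.price π e : ℕ) : ℤ)) := by
      rw [← hC]; push_cast; ring
    rw [h6]
    push_cast at *
    linarith
  exact_mod_cast h5

/-- **Strong duality**: complementary slackness. -/
theorem flowCost_eq_dual [Fintype E] [DecidableEq E] {F : N.Route →₀ ℕ} {f : E → ℕ}
    (hF : N.IsRouteDecomposition δ F f) (hf : ∀ e, f e ≤ N.cap e) {π : V → ℤ}
    (hπ : ∀ e, (f e < N.cap e → 0 ≤ N.transit e + π (N.tail e) - π (N.head e)) ∧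
      (0 < f e → N.transit e + π (N.tail e) - π (N.head e) ≤ 0)) :
    (N.flowCost f : ℤ) =
      δ * (π N.dest - π N.source) - ∑ e, ((N.cap e * N.price π e : ℕ) : ℤ) := by
  obtain ⟨ρ, hρ⟩ := exists_assignment F hF.1
  have h1 := hF.sum_sum_map hρ fun e => π (N.head e) - π (N.tail e)
  have h2 : ∀ i, ((ρ i).edges.map fun e => π (N.head e) - π (N.tail e)).sum =
      π N.dest - π N.source := fun i => sum_map_potential π (ρ i).2
  simp only [h2, Finset.sum_const, Finset.card_univ, Fintype.card_fin, nsmul_eq_mul] at h1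
  rw [h1, ← Finset.sum_sub_distrib, flowCost, Nat.cast_sum]
  refine Finset.sum_congr rfl fun e _ => ?_
  obtain ⟨h3, h4⟩ := hπ e
  -- Below capacity the price is zero, and either `f e` or the excess vanishes; at capacity either
  -- both sides are zero or the excess is nonnegative and equals the price.
  have h5 : (f e : ℤ) * (π (N.head e) - π (N.tail e) - N.transit e) = N.cap e * N.price π e := by
    unfold price
    rcases lt_or_ge (f e) (N.cap e) with h | h
    · have h6 := h3 h
      rw [Int.toNat_of_nonpos (by linarith), Nat.cast_zero, mul_zero]
      rcases Nat.eq_zero_or_pos (f e) with h0 | h0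
      · simp [h0]
      · have := h4 h0
        rw [show π (N.head e) - π (N.tail e) - N.transit e = 0 by linarith, mul_zero]
    · rw [le_antisymm (hf e) h]
      rcases Nat.eq_zero_or_pos (f e) with h0 | h0
      · simp [show N.cap e = 0 by omega]
      · have := h4 h0
        rw [Int.toNat_of_nonneg (by linarith)]
  push_cast
  linarith

/-! ### Averages -/

/-- A lower bound on the total latencies up to a constant is a lower bound on the limit of their
averages. -/
theorem le_liminf_avgLatency {σ : N.Profile δ} {C K : ℕ}
    (h : ∀ T : ℕ, ((T * C : ℕ) : ℕ∞) ≤ ∑ t ∈ Finset.range T, totalLatency σ t + K) :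
    (C : ℝ≥0∞) ≤ liminf (avgLatency σ) atTop := by
  -- The constant error `K` contributes only `K / T` to the average.
  have hlim : Tendsto (fun T : ℕ => (C : ℝ≥0∞) - K / T) atTop (𝓝 C) := by
    have h1 : Tendsto (fun T : ℕ => (K : ℝ≥0∞) / T) atTop (𝓝 0) := by
      have := ENNReal.Tendsto.const_div (a := (K : ℝ≥0∞)) ENNReal.tendsto_nat_nhds_top
        (Or.inr (ENNReal.natCast_ne_top K))
      simpa using this
    simpa using ENNReal.Tendsto.sub (tendsto_const_nhds (x := (C : ℝ≥0∞))) h1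
      (Or.inl (ENNReal.natCast_ne_top C))
  rw [← hlim.liminf_eq]
  refine liminf_le_liminf ?_
  filter_upwards [eventually_gt_atTop 0] with T hT
  rw [tsub_le_iff_right, avgLatency, ← ENNReal.add_div,
    ENNReal.le_div_iff_mul_le (Or.inl (by simpa using hT.ne')) (Or.inl (ENNReal.natCast_ne_top T))]
  have h2 := ENat.toENNReal_mono (h T)
  have h3 : ((∑ t ∈ Finset.range T, totalLatency σ t : ℕ∞) : ℝ≥0∞) =
      ∑ t ∈ Finset.range T, (totalLatency σ t : ℝ≥0∞) :=
    map_sum ENat.toENNRealRingHom _ _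
  rw [ENat.toENNReal_add, h3] at h2
  simpa [mul_comm] using h2

/-- If all generations have the same total latency, then it is the limit of the averages. -/
theorem tendsto_avgLatency_of_const {σ : N.Profile δ} {C : ℕ} (h : ∀ t, totalLatency σ t = C) :
    Tendsto (avgLatency σ) atTop (𝓝 C) := by
  refine tendsto_const_nhds.congr' ?_
  filter_upwards [eventually_gt_atTop 0] with T hT
  have : (T : ℝ≥0∞) ≠ 0 := by simpa using hT.ne'
  simp only [avgLatency, h, Finset.sum_const, Finset.card_range, nsmul_eq_mul,
    ENat.toENNReal_coe]
  rw [mul_comm, ENNReal.mul_div_cancel_right this (ENNReal.natCast_ne_top T)]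

end Network

/-! ### The theorem -/

theorem theorem1 {V E : Type*} [Fintype V] [DecidableEq V] [Fintype E] [DecidableEq E]
    (N : Network V E) (δ : ℕ) (hδ : δ ≤ N.capacity) :
    (∃ (f : E → ℕ) (F : N.Route →₀ ℕ),
      N.IsMinCostFlow δ f ∧ N.IsRouteDecomposition δ F f) ∧
    ∀ (f : E → ℕ) (F : N.Route →₀ ℕ),
      N.IsMinCostFlow δ f → N.IsRouteDecomposition δ F f →
      (∃ σ : N.Profile δ, Network.IsOptimal σ ∧
        (∀ (t : ℕ) (r : N.Route), Network.numOnRoute σ t r = F r) ∧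
        (∀ (p : Player δ) (k : Fin (σ p).edges.length), Network.edgeWait σ p k = 0)) ∧
      (∀ σ : N.Profile δ, Network.IsOptimal σ →
        Tendsto (Network.avgLatency σ) atTop (𝓝 (N.flowCost f : ℝ≥0∞))) := by
  refine ⟨Network.exists_isMinCostFlow_isRouteDecomposition hδ, fun f F hf hF => ?_⟩
  obtain ⟨π, hπ⟩ := hf.exists_potential
  obtain ⟨K, hK⟩ := N.dual_le_sum_totalLatency δ π (Network.flowCost_eq_dual hF hf.1.le_cap hπ)
  have hlow : ∀ σ : N.Profile δ,
      (N.flowCost f : ℝ≥0∞) ≤ liminf (Network.avgLatency σ) atTop :=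
    fun σ => Network.le_liminf_avgLatency (hK σ)
  obtain ⟨ρ, hρ⟩ := Network.exists_assignment F hF.1
  -- The route depends only on the rank, so all generations repeat the same static flow.
  let σ₀ : N.Profile δ := fun p => ρ (ofLex p).2
  have hwait : ∀ (p : Player δ) (k : Fin (σ₀ p).edges.length), Network.edgeWait σ₀ p k = 0 :=
    Network.edgeWait_eq_zero fun e => (hF.sum_count hρ e).trans_le (hf.1.le_cap e)
  have htot : ∀ t, Network.totalLatency σ₀ t = N.flowCost f := by
    intro t
    have h1 := hF.sum_sum_map hρ N.transit
    have h2 : N.flowCost f = ∑ e, f e • N.transit e :=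
      Finset.sum_congr rfl fun e _ => by rw [smul_eq_mul, mul_comm]
    rw [h2, ← h1, Nat.cast_sum]
    exact Finset.sum_congr rfl fun i _ => Network.latency_eq_transitCost (hwait _)
  have hlim := Network.tendsto_avgLatency_of_const htot
  refine ⟨⟨σ₀, fun σ' => hlim.limsup_eq.trans_le (hlow σ'), fun t r => hρ r, hwait⟩, fun σ hσ => ?_⟩
  -- Duality bounds the lower limit from below; optimality against `σ₀` bounds the upper limit from
  -- above by the same value.
  exact tendsto_of_le_liminf_of_limsup_le (hlow σ) ((hσ σ₀).trans_eq hlim.liminf_eq)
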